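/- Let $E$ be a finite set. An interval greedoid $(E,\mathcal F)$ is a nonempty family $\mathcal F$ of subsets of $E$ (the feasible sets) such that for all $X,Y,Z\in\mathcal F$: (IG1) if $X\neq\emptyset$, then $X\setminus\{x\}\in\mathcal F$ for some $x\in X$; (IG2) if $|X|>|Y|$, then $Y\cup\{x\}\in\mathcal F$ for some $x\in X\setminus Y$; (IG3) if $X\subseteq Y\subseteq Z$, $e\in E\setminus Z$ and $X\cup\{e\},Z\cup\{e\}\in\mathcal F$, then $Y\cup\{e\}\in\mathcal F$. For $X\in\mathcal F$ put $\mathcal F/X=\{Y\subseteq E\setminus X: X\cup Y\in\mathcal F\}$ and $\Gamma(X)=\{x\in E\setminus X: X\cup\{x\}\in\mathcal F\}$. Flats are the classes $[X]$ of the equivalence relation $X\sim Y\iff\mathcal F/X=\mathcal F/Y$ on $\mathcal F$; $\Gamma([X])=\Gamma(X)$ is well defined. The set $\Phi$ of flats is ordered by $[X]\le[Y]$ iff $Y\cup Z\sim X$ for some $Z\in\mathcal F/Y$. For a flat $A$ let $\xi(A)=\bigcup_{X\in A}X$, and for $S\subseteq E$ let $\mu(S)=[X]$ for any $X$ maximal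 among the feasible sets contained in $S$ (this does not depend on $X$). Any two flats $A,B$ have a join, $A\vee B=\mu(\xi(A)\cap\xi(B))$. A covector of $(E,\mathcal F)$ is a map $\alpha:E\to\{0,+,-,1\}$ for which there is a flat $A$ such that $\alpha$ takes values in $\{+,-\}$ on $\Gamma(A)$, is $0$ on $\xi(A)$, and is $1$ elsewhere; then $A=\operatorname{supp}(\alpha)=\mu(\{e:\alpha(e)=0\})$. Covectors are ordered by: $\alpha\le\beta$ iff $\operatorname{supp}(\alpha)\le\operatorname{supp}(\beta)$ and $\alpha,\beta$ agree on $\Gamma(\operatorname{supp}(\alpha))\cap\Gamma(\operatorname{supp}(\beta))$. Order the symbols by $0<+,-<1$, with $+$ and $-$ incomparable. The product $\alpha\circ\beta$ of covectors with supports $A,B$ takes at $e\in\Gamma(A\vee B)\cup\xi(A\vee B)$ the value $\beta(e)$ if $\beta(e)>\alpha(e)$ and $\alpha(e)$ otherwise, and takes the value $1$ at all other $e$. Let $-\alpha$ be obtained from $\alpha$ by exchanging $+$ and $-$, and let $S(\alpha,\beta)=\{e:\alpha(e)=-\beta(e)\in\{+,-\}\}$. An oriented interval greedoid is a triple $(E,\mathcal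 F,\mathcal O)$ with $(E,\mathcal F)$ an interval greedoid and $\mathcal O$ a set of covectors of $(E,\mathcal F)$ such that: (OG1) $\operatorname{supp}:\mathcal O\to\Phi$ is surjective; (OG2) if $\alpha\in\mathcal O$, then $-\alpha\in\mathcal O$; (OG3) if $\alpha,\beta\in\mathcal O$, then $\alpha\circ\beta\in\mathcal O$; (OG4) if $\alpha,\beta\in\mathcal O$, $x\in S(\alpha,\beta)$ and $(\alpha\circ\beta)(x)\ne1$, then there is $\gamma\in\mathcal O$ with $\gamma(x)=0$ such that $\gamma(y)=(\alpha\circ\beta)(y)=(\beta\circ\alpha)(y)$ for all $y\notin S(\alpha,\beta)$ with $(\alpha\circ\beta)(y)\neq1$. Let $\hat{\mathcal O}$ be the poset obtained from $\mathcal O$ by adjoining a new maximum element $\hat1$. **Proposition.** Let $(E,\mathcal F,\mathcal O)$ be an oriented interval greedoid. Then every interval of length two in $\hat{\mathcal O}$ has exactly four elements: whenever $\alpha\lessdot\gamma\lessdot\beta$ in $\hat{\mathcal O}$, the interval $[\alpha,\beta]$ has exactly four elements. That is, $\hat{\mathcal O}$ is thin. -/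

import Mathlib

/-- The four symbols that a covector can take as values. -/
inductive CovSign : Type where
  | zero
  | plus
  | minus
  | one

namespace CovSign

/-- The order on the symbols: `zero` is the least element, `one` is the greatest element, and
`plus`, `minus` are incomparable. -/
instance : PartialOrder CovSign where
  le a b := a = b ∨ a = zero ∨ b = one
  le_refl a := Or.inl rfl
  le_trans a b c := by cases a <;> cases b <;> cases c <;> simp
  le_antisymm a b := by cases a <;> cases b <;> simp

/-- Negation exchanges `plus` and `minus`. -/
instance : Neg CovSign where
  neg a := match a with
    | zero => zero
    | plus => minus
    | minus => plus
    | one => one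

end CovSign

/-- An interval greedoid on the ground set `E` (which is finite wherever this is used):
a nonempty family `F` of feasible sets that satisfies (IG1), (IG2), (IG3). -/
structure IntervalGreedoid (E : Type*) [DecidableEq E] where
  F : Set (Finset E)
  nonempty : F.Nonempty
  accessible : ∀ X ∈ F, X.Nonempty → ∃ x ∈ X, X.erase x ∈ F
  exchange : ∀ X ∈ F, ∀ Y ∈ F, Y.card < X.card → ∃ x ∈ X \ Y, insert x Y ∈ F
  interval : ∀ X ∈ F, ∀ Y ∈ F, ∀ Z ∈ F, X ⊆ Y → Y ⊆ Z → ∀ e, e ∉ Z →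
    insert e X ∈ F → insert e Z ∈ F → insert e Y ∈ F

namespace IntervalGreedoid

variable {E : Type*} [DecidableEq E] (G : IntervalGreedoid E)

/-- The family `F / X` of the sets that can be added to `X` preserving feasibility. -/
def contraction (X : Finset E) : Set (Finset E) :=
  {Y | Disjoint Y X ∧ X ∪ Y ∈ G.F}

/-- The continuations `Γ(X)` of a set `X`. -/
def continuations (X : Finset E) : Set E :=
  {x | x ∉ X ∧ insert x X ∈ G.F}

/-- Feasible sets are equivalent if they have the same contraction. -/
instance flatSetoid : Setoid {X : Finset E // X ∈ G.F} where
  r X Y := G.contraction X.1 = G.contraction Y.1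
  iseqv := ⟨fun _ => rfl, fun h => h.symm, fun h k => h.trans k⟩

/-- The flats: the equivalence classes of feasible sets. -/
def Flat : Type _ := Quotient G.flatSetoid

/-- The flat `[X]` of a feasible set `X`. -/
def flatOf (X : Finset E) (hX : X ∈ G.F) : G.Flat := Quotient.mk _ ⟨X, hX⟩

variable {G}

theorem flatOf_eq_iff {X Y : Finset E} (hX : X ∈ G.F) (hY : Y ∈ G.F) :
    G.flatOf X hX = G.flatOf Y hY ↔ G.contraction X = G.contraction Y :=
  Quotient.eq (r := G.flatSetoid)

theorem exists_flatOf (A : G.Flat) : ∃ X, ∃ hX : X ∈ G.F, G.flatOf X hX = A := by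
  induction A using Quotient.inductionOn with
  | h X => exact ⟨X.1, X.2, rfl⟩

theorem empty_mem : ∅ ∈ G.F := by
  obtain ⟨X, hX⟩ := G.nonempty
  induction hn : X.card generalizing X with
  | zero => rw [Finset.card_eq_zero] at hn; exact hn ▸ hX
  | succ n ih =>
    obtain ⟨x, hx, h⟩ := G.accessible X hX (Finset.card_pos.1 (by omega))
    exact ih _ h (by rw [Finset.card_erase_of_mem hx]; omega)

theorem singleton_mem_contraction {X : Finset E} {x : E} :
    {x} ∈ G.contraction X ↔ x ∈ G.continuations X := by
  simp [contraction, continuations, Finset.union_comm X]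

theorem continuations_eq {X Y : Finset E} (h : G.contraction X = G.contraction Y) :
    G.continuations X = G.continuations Y := by
  ext x
  rw [← singleton_mem_contraction, h, singleton_mem_contraction]

theorem contraction_union {X Y Z : Finset E} (h : G.contraction X = G.contraction Y)
    (hZ : Z ∈ G.contraction X) : G.contraction (X ∪ Z) = G.contraction (Y ∪ Z) := by
  have hZ' : Z ∈ G.contraction Y := h ▸ hZ
  ext W
  have h1 : W ∪ Z ∈ G.contraction X ↔ W ∪ Z ∈ G.contraction Y := by rw [h]
  have e : ∀ U : Finset E, U ∪ (W ∪ Z) = U ∪ Z ∪ W := fun U => by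
    rw [Finset.union_assoc, Finset.union_comm W]
  simp only [contraction, Set.mem_ofPred_eq, Finset.disjoint_union_left,
    Finset.disjoint_union_right, e] at h1 hZ hZ' ⊢
  tauto

theorem card_le_of_contraction_eq {X Y : Finset E} (hX : X ∈ G.F) (hY : Y ∈ G.F)
    (h : G.contraction X = G.contraction Y) : X.card ≤ Y.card := by
  by_contra! hlt
  obtain ⟨x, hx, hxY⟩ := G.exchange X hX Y hY hlt
  rw [Finset.mem_sdiff] at hx
  have : x ∈ G.continuations Y := ⟨hx.2, hxY⟩
  rw [← continuations_eq h] at this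
  exact this.1 hx.1

/-- `[X] ≤ [Y]` if there is `Z ∈ F / Y` with `Y ∪ Z` equivalent to `X`. -/
instance : LE G.Flat where
  le A B := ∃ Y, ∃ hY : Y ∈ G.F, G.flatOf Y hY = B ∧
    ∃ Z, ∃ hZ : Z ∈ G.contraction Y, G.flatOf (Y ∪ Z) hZ.2 = A

theorem flatOf_le_iff {A : G.Flat} {Y : Finset E} (hY : Y ∈ G.F) :
    A ≤ G.flatOf Y hY ↔ ∃ Z, ∃ hZ : Z ∈ G.contraction Y, G.flatOf (Y ∪ Z) hZ.2 = A := by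
  constructor
  · rintro ⟨Y', hY', h, Z, hZ, rfl⟩
    rw [flatOf_eq_iff] at h
    have hZ' : Z ∈ G.contraction Y := h ▸ hZ
    exact ⟨Z, hZ', (flatOf_eq_iff _ _).2 (contraction_union h hZ).symm⟩
  · rintro ⟨Z, hZ, h⟩
    exact ⟨Y, hY, rfl, Z, hZ, h⟩

theorem le_iff_subset {A : G.Flat} {Y : Finset E} (hY : Y ∈ G.F) :
    A ≤ G.flatOf Y hY ↔ ∃ X, ∃ hX : X ∈ G.F, Y ⊆ X ∧ G.flatOf X hX = A := by
  rw [flatOf_le_iff]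
  constructor
  · rintro ⟨Z, hZ, h⟩
    exact ⟨_, hZ.2, Finset.subset_union_left, h⟩
  · rintro ⟨X, hX, hYX, rfl⟩
    refine ⟨X \ Y, ⟨Finset.sdiff_disjoint, ?_⟩, ?_⟩
    · rwa [Finset.union_sdiff_of_subset hYX]
    · rw [flatOf_eq_iff, Finset.union_sdiff_of_subset hYX]

/-- The poset of flats. -/
instance : PartialOrder G.Flat where
  le_refl A := by
    obtain ⟨X, hX, rfl⟩ := exists_flatOf A
    exact (le_iff_subset hX).2 ⟨X, hX, subset_rfl, rfl⟩
  le_trans A B C hAB hBC := by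
    obtain ⟨Z, hZ, rfl⟩ := exists_flatOf C
    obtain ⟨Y, hY, hZY, rfl⟩ := (le_iff_subset hZ).1 hBC
    obtain ⟨X, hX, hYX, rfl⟩ := (le_iff_subset hY).1 hAB
    exact (le_iff_subset hZ).2 ⟨X, hX, hZY.trans hYX, rfl⟩
  le_antisymm A B hAB hBA := by
    obtain ⟨Y, hY, rfl⟩ := exists_flatOf B
    obtain ⟨X, hX, hYX, rfl⟩ := (le_iff_subset hY).1 hAB
    obtain ⟨Y', hY', hXY', h⟩ := (le_iff_subset hX).1 hBA
    have h1 := card_le_of_contraction_eq hY' hY ((flatOf_eq_iff _ _).1 h)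
    have h2 := Finset.card_le_card hXY'
    obtain rfl := Finset.eq_of_subset_of_card_le hYX (by omega)
    rfl

/-- The continuations `Γ(A)` of a flat `A`. -/
def Flat.Γ (A : G.Flat) : Set E :=
  Quotient.lift (fun X : {X : Finset E // X ∈ G.F} => G.continuations X.1)
    (fun _ _ h => continuations_eq h) A

/-- `ξ(A)` is the union of the feasible sets in the flat `A`. -/
def Flat.ξ (A : G.Flat) : Set E :=
  {x | ∃ X, ∃ hX : X ∈ G.F, G.flatOf X hX = A ∧ x ∈ X}

/-- `X` is maximal among the feasible sets contained in `S`. -/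
def IsMaximalFeasibleIn (G : IntervalGreedoid E) (S : Set E) (X : Finset E) : Prop :=
  Maximal (fun X : Finset E => X ∈ G.F ∧ (X : Set E) ⊆ S) X

theorem exists_maximal_ge [Fintype E] {S : Set E} {Y : Finset E} (hY : Y ∈ G.F)
    (hYS : (Y : Set E) ⊆ S) : ∃ X, Y ⊆ X ∧ G.IsMaximalFeasibleIn S X := by
  have hfin : {X : Finset E | X ∈ G.F ∧ (X : Set E) ⊆ S}.Finite := Set.toFinite _
  obtain ⟨X, h1, h2⟩ := hfin.exists_le_maximal (a := Y) ⟨hY, hYS⟩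
  exact ⟨X, h1, h2⟩

theorem exists_maximal [Fintype E] (S : Set E) : ∃ X, G.IsMaximalFeasibleIn S X := by
  obtain ⟨X, -, h⟩ := exists_maximal_ge (G := G) (S := S) empty_mem (by simp)
  exact ⟨X, h⟩

/-- `μ(S) = [X]`, where `X` is maximal among the feasible sets contained in `S`. The choice of `X`
does not matter, see `mu_eq` below. -/
noncomputable def mu [Fintype E] (S : Set E) : G.Flat :=
  G.flatOf (Classical.choose (exists_maximal (G := G) S))
    (Classical.choose_spec (exists_maximal (G := G) S)).1.1

theorem augment {X Y : Finset E} (hX : X ∈ G.F) (hY : Y ∈ G.F) (h : Y.card ≤ X.card) :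
    ∃ Z ∈ G.F, Y ⊆ Z ∧ Z ⊆ X ∪ Y ∧ Z.card = X.card := by
  induction hn : X.card - Y.card generalizing Y with
  | zero => exact ⟨Y, hY, subset_rfl, Finset.subset_union_right, by omega⟩
  | succ n ih =>
    obtain ⟨x, hx, hxY⟩ := G.exchange X hX Y hY (by omega)
    rw [Finset.mem_sdiff] at hx
    have hc := Finset.card_insert_of_notMem hx.2
    obtain ⟨Z, hZ, h1, h2, h3⟩ := ih hxY (by omega) (by omega)
    refine ⟨Z, hZ, (Finset.subset_insert _ _).trans h1, fun z hz => ?_, h3⟩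
    have := h2 hz
    simp only [Finset.mem_union, Finset.mem_insert] at this ⊢
    rcases this with h | rfl | h
    exacts [Or.inl h, Or.inl hx.1, Or.inr h]

theorem contraction_adjacent {P : Finset E} {v : E} (hP : P ∈ G.F) (hvP : insert v P ∈ G.F)
    (n : ℕ) : ∀ U ∈ G.F, ∀ V ∈ G.F, ∀ W : Finset E, W.card = n → P ⊆ U → v ∉ U →
      insert v U ∉ G.F → V ⊆ insert v U → V.card = U.card → Disjoint W U → U ∪ W ∈ G.F →
      v ∉ W ∧ V ∪ W ∈ G.F := by
  induction n with
  | zero =>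
    intro U hU V hV W hW _ _ _ _ _ _ _
    rw [Finset.card_eq_zero] at hW
    subst hW
    simpa using hV
  | succ n ih =>
    intro U hU V hV W hW hPU hvU hvU' hVU hc hd hUW
    have hlt : U.card < (U ∪ W).card := by
      rw [Finset.card_union_of_disjoint hd.symm]; omega
    obtain ⟨w, hw, hwU⟩ := G.exchange _ hUW U hU hlt
    simp only [Finset.mem_sdiff, Finset.mem_union] at hw
    have hwW : w ∈ W := by tauto
    have hwv : w ≠ v := by rintro rfl; exact hvU' hwU
    have hwV : w ∉ V := fun h => by
      have := hVU h
      simp only [Finset.mem_insert] at this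
      tauto
    have hcU := Finset.card_insert_of_notMem hw.2
    have hcV := Finset.card_insert_of_notMem hwV
    have hVw : insert w V ∈ G.F := by
      obtain ⟨z, hz, hzV⟩ := G.exchange _ hwU V hV (by omega)
      simp only [Finset.mem_sdiff, Finset.mem_insert] at hz
      rcases hz.1 with rfl | hzU
      · exact hzV
      · refine absurd ?_ hvU'
        have hsub : insert z V ⊆ insert v U := by
          intro y hy
          rcases Finset.mem_insert.1 hy with rfl | hy
          · exact Finset.mem_insert_of_mem hzU
          · exact hVU hy
        have h1 := Finset.card_insert_of_notMem hz.2
        have h2 := Finset.card_insert_of_notMem hvU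
        rwa [← Finset.eq_of_subset_of_card_le hsub (by omega)]
    have hvw : v ∉ insert w U := by
      simp only [Finset.mem_insert]; tauto
    have hun : ∀ T : Finset E, insert w T ∪ W.erase w = T ∪ W := fun T => by
      ext y
      simp only [Finset.mem_union, Finset.mem_insert, Finset.mem_erase]
      by_cases hy : y = w
      · subst hy; tauto
      · tauto
    obtain ⟨h1, h2⟩ := ih (insert w U) hwU (insert w V) hVw (W.erase w)
      (by rw [Finset.card_erase_of_mem hwW]; omega)
      (hPU.trans (Finset.subset_insert _ _)) hvw
      (fun h => hvU' (G.interval P hP U hU _ hwU hPU (Finset.subset_insert _ _) v hvw hvP h))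
      (by rw [Finset.insert_comm]; exact Finset.insert_subset_insert _ hVU)
      (by omega)
      (by
        rw [Finset.disjoint_left] at hd ⊢
        intro y hy
        simp only [Finset.mem_erase, Finset.mem_insert] at hy ⊢
        have := hd hy.2
        tauto)
      (by rwa [hun])
    rw [hun] at h2
    simp only [Finset.mem_erase] at h1
    exact ⟨by tauto, h2⟩

theorem contraction_subset {S : Set E} {V : Finset E} (hV : V ∈ G.F) (hVS : (V : Set E) ⊆ S)
    (hmax : ∀ X ∈ G.F, (X : Set E) ⊆ S → X.card ≤ V.card) (n : ℕ) :
    ∀ P ∈ G.F, ∀ U ∈ G.F, (U : Set E) ⊆ S → U.card = V.card → P ⊆ U → P ⊆ V →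
      V.card - P.card = n → G.contraction U ⊆ G.contraction V := by
  induction n with
  | zero =>
    intro P hP U hU hUS hc hPU hPV hn
    have h1 := Finset.eq_of_subset_of_card_le hPU (by omega)
    have h2 := Finset.eq_of_subset_of_card_le hPV (by omega)
    rw [← h1, ← h2]
  | succ n ih =>
    intro P hP U hU hUS hc hPU hPV hn
    obtain ⟨v, hv, hvP⟩ := G.exchange V hV P hP (by omega)
    rw [Finset.mem_sdiff] at hv
    have hcP := Finset.card_insert_of_notMem hv.2
    have hPV' : insert v P ⊆ V := Finset.insert_subset hv.1 hPV
    by_cases hvU : v ∈ U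
    · exact ih _ hvP U hU hUS hc (Finset.insert_subset hvU hPU) hPV' (by omega)
    · have hcU := Finset.card_insert_of_notMem hvU
      have hS : ((insert v U : Finset E) : Set E) ⊆ S := by
        intro y hy
        rcases Finset.mem_insert.1 (Finset.mem_coe.1 hy) with rfl | hy
        · exact hVS hv.1
        · exact hUS hy
      have hvU' : insert v U ∉ G.F := fun h => by
        have := hmax _ h hS
        omega
      obtain ⟨U', hU', h1, h2, h3⟩ := augment hU hvP (by omega)
      have h4 : U' ⊆ insert v U := by
        intro y hy
        have := h2 hy
        simp only [Finset.mem_union, Finset.mem_insert] at this ⊢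
        rcases this with h | h | h
        exacts [Or.inr h, Or.inl h, Or.inr (hPU h)]
      refine subset_trans ?_ (ih _ hvP U' hU' (subset_trans (Finset.coe_subset.2 h4) hS)
        (by omega) h1 hPV' (by omega))
      rintro W ⟨hW, hUW⟩
      obtain ⟨h5, h6⟩ := contraction_adjacent hP hvP _ U hU U' hU' W rfl hPU hvU hvU' h4 h3 hW hUW
      refine ⟨?_, h6⟩
      rw [Finset.disjoint_left] at hW ⊢
      intro y hy hy'
      rcases Finset.mem_insert.1 (h4 hy') with rfl | h
      exacts [h5 hy, hW hy h]

theorem IsMaximalFeasibleIn.card_le {S : Set E} {U X : Finset E} (hU : G.IsMaximalFeasibleIn S U)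
    (hX : X ∈ G.F) (hXS : (X : Set E) ⊆ S) : X.card ≤ U.card := by
  by_contra! hlt
  obtain ⟨x, hx, h⟩ := G.exchange X hX U hU.1.1 hlt
  rw [Finset.mem_sdiff] at hx
  have hS : ((insert x U : Finset E) : Set E) ⊆ S := by
    rw [Finset.coe_insert]
    exact Set.insert_subset (hXS hx.1) hU.1.2
  exact hx.2 (hU.2 ⟨h, hS⟩ (Finset.subset_insert _ _) (Finset.mem_insert_self _ _))

/-- All maximal feasible subsets of a given set are equivalent. -/
theorem IsMaximalFeasibleIn.contraction_eq {S : Set E} {U V : Finset E}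
    (hU : G.IsMaximalFeasibleIn S U) (hV : G.IsMaximalFeasibleIn S V) :
    G.contraction U = G.contraction V := by
  have hc := le_antisymm (hV.card_le hU.1.1 hU.1.2) (hU.card_le hV.1.1 hV.1.2)
  exact Set.Subset.antisymm
    (contraction_subset hV.1.1 hV.1.2 (fun _ => hV.card_le) _ ∅ empty_mem U hU.1.1 hU.1.2 hc
      (by simp) (by simp) rfl)
    (contraction_subset hU.1.1 hU.1.2 (fun _ => hU.card_le) _ ∅ empty_mem V hV.1.1 hV.1.2 hc.symm
      (by simp) (by simp) rfl)

theorem isMaximalFeasibleIn_ξ {X : Finset E} (hX : X ∈ G.F) :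
    G.IsMaximalFeasibleIn (G.flatOf X hX).ξ X := by
  refine ⟨⟨hX, fun x hx => ⟨X, hX, rfl, hx⟩⟩, ?_⟩
  rintro Y ⟨hY, hYS⟩ hXY
  by_contra hne
  have hlt : X.card < Y.card :=
    Finset.card_lt_card (Finset.ssubset_iff_subset_ne.2 ⟨hXY, fun h => hne (h ▸ le_rfl)⟩)
  obtain ⟨y, hy, h⟩ := G.exchange Y hY X hX hlt
  rw [Finset.mem_sdiff] at hy
  obtain ⟨X', hX', he, hyX'⟩ := hYS hy.1
  have hyX : y ∈ G.continuations X := ⟨hy.2, h⟩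
  rw [← continuations_eq ((flatOf_eq_iff _ _).1 he)] at hyX
  exact hyX.1 hyX'

theorem ξ_antitone {A B : G.Flat} (h : A ≤ B) : B.ξ ⊆ A.ξ := by
  rintro x ⟨Y, hY, rfl, hx⟩
  obtain ⟨X, hX, hYX, rfl⟩ := (le_iff_subset hY).1 h
  exact ⟨X, hX, rfl, hYX hx⟩

theorem Γ_inter_subset {A B C : G.Flat} (hAB : A ≤ B) (hBC : B ≤ C) : A.Γ ∩ C.Γ ⊆ B.Γ := by
  obtain ⟨Z, hZ, rfl⟩ := exists_flatOf C
  obtain ⟨Y, hY, hZY, rfl⟩ := (le_iff_subset hZ).1 hBC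
  obtain ⟨X, hX, hYX, rfl⟩ := (le_iff_subset hY).1 hAB
  rintro e ⟨⟨heX, h1⟩, ⟨_, h2⟩⟩
  exact ⟨fun h => heX (hYX h), G.interval Z hZ Y hY X hX hZY hYX e heX h2 h1⟩

section

variable [Fintype E]

theorem mu_eq {S : Set E} {X : Finset E} (hX : G.IsMaximalFeasibleIn S X) :
    G.mu S = G.flatOf X hX.1.1 :=
  (flatOf_eq_iff _ _).2
    ((Classical.choose_spec (exists_maximal (G := G) S)).contraction_eq hX)

theorem mu_ξ (A : G.Flat) : G.mu A.ξ = A := by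
  obtain ⟨X, hX, rfl⟩ := exists_flatOf A
  exact mu_eq (isMaximalFeasibleIn_ξ hX)

theorem le_flatOf_of_subset {A : G.Flat} {Y : Finset E} (hY : Y ∈ G.F)
    (h : (Y : Set E) ⊆ A.ξ) : A ≤ G.flatOf Y hY := by
  obtain ⟨X, hYX, hX⟩ := exists_maximal_ge hY h
  refine (le_iff_subset hY).2 ⟨X, hX.1.1, hYX, ?_⟩
  rw [← mu_eq hX, mu_ξ]

/-- The join of two flats `A`, `B` is `μ(ξ(A) ∩ ξ(B))`. -/
noncomputable instance : SemilatticeSup G.Flat where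
  sup A B := G.mu (A.ξ ∩ B.ξ)
  le_sup_left A B := by
    obtain ⟨X, hX⟩ := exists_maximal (G := G) (A.ξ ∩ B.ξ)
    simp only [mu_eq hX]
    exact le_flatOf_of_subset hX.1.1 (hX.1.2.trans Set.inter_subset_left)
  le_sup_right A B := by
    obtain ⟨X, hX⟩ := exists_maximal (G := G) (A.ξ ∩ B.ξ)
    simp only [mu_eq hX]
    exact le_flatOf_of_subset hX.1.1 (hX.1.2.trans Set.inter_subset_right)
  sup_le A B C hA hB := by
    obtain ⟨Y, hY, rfl⟩ := exists_flatOf C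
    have hsub : (Y : Set E) ⊆ A.ξ ∩ B.ξ := fun y hy =>
      ⟨ξ_antitone hA ⟨Y, hY, rfl, hy⟩, ξ_antitone hB ⟨Y, hY, rfl, hy⟩⟩
    obtain ⟨X, hYX, hX⟩ := exists_maximal_ge hY hsub
    simp only [mu_eq hX]
    exact (le_iff_subset hY).2 ⟨X, hX.1.1, hYX, rfl⟩

/-- `α` is the covector of a signed flat `(A, α')` with underlying flat `A`: it takes values in
`{+, -}` on `Γ(A)` (where it equals `α'`), is `0` on `ξ(A)`, and is `1` elsewhere. -/
def IsCovectorOver (A : G.Flat) (α : E → CovSign) : Prop :=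
  (∀ e ∈ A.Γ, α e = CovSign.plus ∨ α e = CovSign.minus) ∧
  (∀ e ∈ A.ξ, α e = CovSign.zero) ∧
  (∀ e, e ∉ A.Γ → e ∉ A.ξ → α e = CovSign.one)

variable (G) in
/-- The covectors of `G` are the covectors of its signed flats. -/
def IsCovector (α : E → CovSign) : Prop := ∃ A : G.Flat, IsCovectorOver A α

variable (G) in
/-- The support of a covector. -/
noncomputable def supp (α : E → CovSign) : G.Flat := G.mu {x | α x = CovSign.zero}

/-- The support of the covector of a signed flat is the underlying flat. -/
theorem IsCovectorOver.supp_eq {A : G.Flat} {α : E → CovSign} (h : IsCovectorOver A α) :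
    G.supp α = A := by
  have : {x | α x = CovSign.zero} = A.ξ := by
    ext x
    refine ⟨fun hx => ?_, h.2.1 x⟩
    rw [Set.mem_ofPred_eq] at hx
    by_contra hξ
    by_cases hΓ : x ∈ A.Γ
    · rcases h.1 x hΓ with h' | h' <;> simp [h'] at hx
    · simp [h.2.2 x hΓ hξ] at hx
  rw [supp, this, mu_ξ]

theorem IsCovector.over_supp {α : E → CovSign} (h : G.IsCovector α) :
    IsCovectorOver (G.supp α) α := by
  obtain ⟨A, hA⟩ := h
  rwa [hA.supp_eq]

open Classical in
variable (G) in
/-- The product `α ∘ β` of two covectors. On `Γ(A ∨ B) ∪ ξ(A ∨ B)`, where `A`, `B` are the supports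
of `α`, `β`, its value is `β(e)` if `β(e) > α(e)`, and `α(e)` otherwise. Elsewhere it is `1`. -/
noncomputable def comp (α β : E → CovSign) (e : E) : CovSign :=
  if e ∈ (G.supp α ⊔ G.supp β).Γ ∪ (G.supp α ⊔ G.supp β).ξ then
    if α e < β e then β e else α e
  else CovSign.one

end

end IntervalGreedoid

/-- The separation set of `α` and `β`: the elements at which they take opposite values
in `{+, -}`. -/
def separationSet {E : Type*} (α β : E → CovSign) : Set E :=
  {e | α e = -β e ∧ (α e = CovSign.plus ∨ α e = CovSign.minus)}

/-- An oriented interval greedoid: an interval greedoid with a set of covectors that satisfies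
(OG1), (OG2), (OG3), (OG4). -/
structure OrientedIntervalGreedoid (E : Type*) [Fintype E] [DecidableEq E] extends
    IntervalGreedoid E where
  covectors : Set (E → CovSign)
  isCovector : ∀ α ∈ covectors, toIntervalGreedoid.IsCovector α
  supp_surjective : ∀ A : toIntervalGreedoid.Flat, ∃ α ∈ covectors, toIntervalGreedoid.supp α = A
  neg_mem : ∀ α ∈ covectors, -α ∈ covectors
  comp_mem : ∀ α ∈ covectors, ∀ β ∈ covectors, toIntervalGreedoid.comp α β ∈ covectors
  elimination : ∀ α ∈ covectors, ∀ β ∈ covectors, ∀ x ∈ separationSet α β,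
    toIntervalGreedoid.comp α β x ≠ CovSign.one →
    ∃ γ ∈ covectors, γ x = CovSign.zero ∧
      ∀ y, y ∉ separationSet α β → toIntervalGreedoid.comp α β y ≠ CovSign.one →
        γ y = toIntervalGreedoid.comp α β y ∧ γ y = toIntervalGreedoid.comp β α y

namespace OrientedIntervalGreedoid

variable {E : Type*} [Fintype E] [DecidableEq E]

/-- The set of covectors of an oriented interval greedoid, as a type that carries the partial
order below. -/
def Covector (O : OrientedIntervalGreedoid E) : Type _ := {α : E → CovSign // α ∈ O.covectors}

/-- The flat that supports a covector. -/
noncomputable def Covector.flat {O : OrientedIntervalGreedoid E} (α : O.Covector) :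
    O.toIntervalGreedoid.Flat := O.toIntervalGreedoid.supp α.1

/-- The order of signed flats: `α ≤ β` if the flat of `α` is at most the flat of `β` and the
signs agree on the common continuations of the two flats. -/
noncomputable instance (O : OrientedIntervalGreedoid E) : PartialOrder O.Covector where
  le α β := α.flat ≤ β.flat ∧ ∀ e ∈ α.flat.Γ ∩ β.flat.Γ, α.1 e = β.1 e
  le_refl α := ⟨le_rfl, fun _ _ => rfl⟩
  le_trans α β γ h k := ⟨h.1.trans k.1, fun e he => by
    have he' := IntervalGreedoid.Γ_inter_subset h.1 k.1 he
    rw [h.2 e ⟨he.1, he'⟩, k.2 e ⟨he', he.2⟩]⟩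
  le_antisymm α β h k := by
    have hf : α.flat = β.flat := le_antisymm h.1 k.1
    have hα := (O.isCovector α.1 α.2).over_supp
    have hβ := (O.isCovector β.1 β.2).over_supp
    change IntervalGreedoid.IsCovectorOver α.flat _ at hα
    change IntervalGreedoid.IsCovectorOver β.flat _ at hβ
    rw [← hf] at hβ
    refine Subtype.ext (funext fun e => ?_)
    by_cases h1 : e ∈ α.flat.Γ
    · exact h.2 e ⟨h1, hf ▸ h1⟩
    · by_cases h2 : e ∈ α.flat.ξ
      · rw [hα.2.1 e h2, hβ.2.1 e h2]
      · rw [hα.2.2 e h1 h2, hβ.2.2 e h1 h2]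

/-- The covectors with a new greatest element adjoined. -/
abbrev Hat (O : OrientedIntervalGreedoid E) : Type _ := WithTop O.Covector

end OrientedIntervalGreedoid

/-- A poset is thin if every interval `[a, b]` of length two, that is, with a maximal chain
`a ⋖ c ⋖ b`, has exactly four elements. -/
def IsThin (P : Type*) [PartialOrder P] : Prop :=
  ∀ a b : P, (∃ c, a ⋖ c ∧ c ⋖ b) → (Set.Icc a b).ncard = 4

/-!
Signs on flats behave as in an oriented matroid because a continuation of a flat `B` is, for every
flat `A ≤ B`, either still a continuation of `A` or an element of `ξ(A)` (`Γ_subset_union`). Hence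
the product `α ∘ β` is given on `Γ(A ∨ B)` by the usual rule, and the only signs of a covector
`γ ≥ α` on `Γ(γ)` that `α` leaves free are those on `ξ(α)`. Reversing them gives the reflection
`α ∘ (-γ)` of `γ` in `α`.

The main tool is elimination between two covectors above `α` (`exists_elimination`): multiplying
the outcome by `α` from the left keeps it above `α`, and its flat drops strictly below the join,
because it absorbs the eliminated element. There are three consequences.

* If the flat of `γ` covers the flat of `α`, then `γ` and its reflection are the only extensions
  of `α` over that flat (`eq_or_eq_comp_neg`).
* A covector `δ ≥ α` with flat below that of `β ≥ α`, but with signs that conflict with those of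
  `β`, is moved by repeated elimination to a covector strictly between `α` and `β`
  (`exists_between`). Therefore covering pairs of covectors have
  covering pairs of flats (`flat_covBy`), and if `γ` lies between `α` and `β`, then so does a second
  covector, obtained from the reflection of `γ` (`exists_ne_between`).
* Three covectors with three different flats inside an interval of length two would lead by
  elimination to a third extension of `α` over one of these flats (`false_of_three_flats`). Two
  covectors over the same flat in the interval exclude all other flats (`flat_eq_of_between`).

An interval of length two that ends in the adjoined top element is covered by the first point:
the flat of a maximal covector is `[∅]`, and the flat of `α` is covered by it. All other intervals
are covered by the last two points.
-/

/-! ### Covering pairs and signs -/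

theorem CovBy.eq_left_of_le_of_lt {P : Type*} [PartialOrder P] {a b c : P} (h : a ⋖ b)
    (hac : a ≤ c) (hcb : c < b) : c = a :=
  (h.eq_or_eq hac hcb.le).resolve_right hcb.ne

theorem CovBy.eq_right_of_lt_of_le {P : Type*} [PartialOrder P] {a b c : P} (h : a ⋖ b)
    (hac : a < c) (hcb : c ≤ b) : c = b :=
  (h.eq_or_eq hac.le hcb).resolve_left hac.ne'

namespace CovSign

theorem zero_lt_iff {a : CovSign} : zero < a ↔ a ≠ zero := by
  rw [lt_iff_le_and_ne]
  exact ⟨fun h => h.2.symm, fun h => ⟨Or.inr (Or.inl rfl), h.symm⟩⟩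

theorem not_lt_of_sign {a b : CovSign} (ha : a = plus ∨ a = minus) (hb : b ≠ one) :
    ¬ a < b := by
  intro h
  rcases h.le with h' | h' | h'
  · exact h.ne h'
  · rcases ha with ha | ha <;> simp [ha] at h'
  · exact hb h'

theorem neg_zero' : -zero = zero := rfl
theorem neg_one' : -one = one := rfl

theorem neg_neg' (a : CovSign) : - -a = a := by cases a <;> rfl

theorem neg_sign {a : CovSign} (ha : a = plus ∨ a = minus) : -a = plus ∨ -a = minus := by
  rcases ha with rfl | rfl
  · exact Or.inr rfl
  · exact Or.inl rfl

theorem sign_ne_zero {a : CovSign} (ha : a = plus ∨ a = minus) : a ≠ zero := by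
  rcases ha with rfl | rfl <;> simp

theorem sign_ne_one {a : CovSign} (ha : a = plus ∨ a = minus) : a ≠ one := by
  rcases ha with rfl | rfl <;> simp

theorem sign_ne_neg {a : CovSign} (ha : a = plus ∨ a = minus) : a ≠ -a := by
  rcases ha with rfl | rfl
  · exact fun h => CovSign.noConfusion (show plus = minus from h)
  · exact fun h => CovSign.noConfusion (show minus = plus from h)

theorem sign_eq_or_eq_neg {a b : CovSign} (ha : a = plus ∨ a = minus)
    (hb : b = plus ∨ b = minus) : a = b ∨ a = -b := by
  rcases ha with rfl | rfl <;> rcases hb with rfl | rfl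
  exacts [Or.inl rfl, Or.inr rfl, Or.inr rfl, Or.inl rfl]

end CovSign

/-! ### Flats of an interval greedoid -/

namespace IntervalGreedoid

section Flats

variable {E : Type*} [DecidableEq E] {G : IntervalGreedoid E}

/-- The common cardinality of the feasible sets in a flat. It reverses the order of the flats. -/
def Flat.rank (A : G.Flat) : ℕ :=
  Quotient.lift (fun X : {X : Finset E // X ∈ G.F} => X.1.card)
    (fun X Y h => le_antisymm (card_le_of_contraction_eq X.2 Y.2 h)
      (card_le_of_contraction_eq Y.2 X.2 h.symm)) A

theorem subset_ξ {X : Finset E} (hX : X ∈ G.F) : (X : Set E) ⊆ (G.flatOf X hX).ξ :=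
  fun _ hx => ⟨X, hX, rfl, hx⟩

theorem rank_lt_of_lt {A B : G.Flat} (h : A < B) : B.rank < A.rank := by
  obtain ⟨Y, hY, rfl⟩ := exists_flatOf B
  obtain ⟨X, hX, hYX, rfl⟩ := (le_iff_subset hY).1 h.le
  refine Finset.card_lt_card (Finset.ssubset_iff_subset_ne.2 ⟨hYX, ?_⟩)
  rintro rfl
  exact h.ne rfl

theorem exists_mem_Γ_of_lt {A B : G.Flat} (h : A < B) : ∃ e ∈ B.Γ, e ∈ A.ξ := by
  have hr := rank_lt_of_lt h
  obtain ⟨Y, hY, rfl⟩ := exists_flatOf B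
  obtain ⟨X, hX, hYX, rfl⟩ := (le_iff_subset hY).1 h.le
  obtain ⟨e, he, heY⟩ := G.exchange X hX Y hY hr
  rw [Finset.mem_sdiff] at he
  exact ⟨e, ⟨he.2, heY⟩, subset_ξ hX he.1⟩

theorem covBy_of_rank_eq {A B : G.Flat} (h : A < B) (hr : A.rank = B.rank + 1) : A ⋖ B := by
  refine ⟨h, fun C hAC hCB => ?_⟩
  have h1 := rank_lt_of_lt hAC
  have h2 := rank_lt_of_lt hCB
  omega

variable (G) in
theorem flatOf_empty_le (A : G.Flat) : A ≤ G.flatOf ∅ empty_mem := by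
  obtain ⟨X, hX, rfl⟩ := exists_flatOf A
  exact (le_iff_subset empty_mem).2 ⟨X, hX, Finset.empty_subset X, rfl⟩

/-- A continuation of a flat remains a continuation of each smaller flat, or is absorbed by it:
if it is no longer a continuation, an exchange brings it into an equivalent feasible set. -/
theorem Γ_subset_union {A B : G.Flat} (h : A ≤ B) : B.Γ ⊆ A.Γ ∪ A.ξ := by
  obtain ⟨Y, hY, rfl⟩ := exists_flatOf B
  obtain ⟨X, hX, hYX, rfl⟩ := (le_iff_subset hY).1 h
  rintro e ⟨heY, he⟩
  by_cases heX : e ∈ X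
  · exact Or.inr (subset_ξ hX heX)
  by_cases hXe : insert e X ∈ G.F
  · exact Or.inl ⟨heX, hXe⟩
  have hc := Finset.card_insert_of_notMem heX
  have hmax : ∀ Z : Finset E, Z ∈ G.F → Z ⊆ insert e X → Z.card = X.card →
      G.IsMaximalFeasibleIn (insert e X : Finset E) Z := by
    refine fun Z hZ hZX hZc => ⟨⟨hZ, Finset.coe_subset.2 hZX⟩, ?_⟩
    rintro W ⟨hW, hWX⟩ hZW
    have hWX := Finset.coe_subset.1 hWX
    have hne : W ≠ insert e X := fun h => hXe (h ▸ hW)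
    have := Finset.card_lt_card (Finset.ssubset_iff_subset_ne.2 ⟨hWX, hne⟩)
    exact (Finset.eq_of_subset_of_card_le hZW (by omega)).ge
  have hlt : (insert e Y).card ≤ X.card := by
    rw [Finset.card_insert_of_notMem heY]
    refine Finset.card_lt_card (Finset.ssubset_iff_subset_ne.2 ⟨hYX, ?_⟩)
    rintro rfl
    exact hXe he
  obtain ⟨Z, hZ, h1, h2, h3⟩ := augment hX he hlt
  have h4 : Z ⊆ insert e X := fun z hz => by
    have := h2 hz
    simp only [Finset.mem_union, Finset.mem_insert] at this ⊢
    rcases this with h | h | h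
    exacts [Or.inr h, Or.inl h, Or.inr (hYX h)]
  have h5 := (hmax Z hZ h4 h3).contraction_eq (hmax X hX (Finset.subset_insert _ _) rfl)
  exact Or.inr ⟨Z, hZ, (flatOf_eq_iff hZ hX).2 h5, h1 (Finset.mem_insert_self _ _)⟩

namespace IsCovectorOver

variable {A : G.Flat} {α : E → CovSign}

theorem eq_zero_iff (h : IsCovectorOver A α) {e : E} : α e = CovSign.zero ↔ e ∈ A.ξ := by
  refine ⟨fun h0 => ?_, h.2.1 e⟩
  by_contra hξ
  by_cases hΓ : e ∈ A.Γ
  · exact CovSign.sign_ne_zero (h.1 e hΓ) h0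
  · simp [h.2.2 e hΓ hξ] at h0

theorem sign_iff (h : IsCovectorOver A α) {e : E} :
    (α e = CovSign.plus ∨ α e = CovSign.minus) ↔ e ∈ A.Γ := by
  refine ⟨fun h0 => ?_, h.1 e⟩
  by_contra hΓ
  by_cases hξ : e ∈ A.ξ
  · simp [h.2.1 e hξ] at h0
  · simp [h.2.2 e hΓ hξ] at h0

theorem neg (h : IsCovectorOver A α) : IsCovectorOver A (-α) := by
  refine ⟨fun e he => CovSign.neg_sign (h.1 e he), fun e he => ?_, fun e h1 h2 => ?_⟩
  · rw [Pi.neg_apply, h.2.1 e he, CovSign.neg_zero']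
  · rw [Pi.neg_apply, h.2.2 e h1 h2, CovSign.neg_one']

end IsCovectorOver

variable [Fintype E]

/-- A continuation `e` of a flat `B` determines a flat covered by `B`, the largest of the
flats below `B` whose feasible sets can contain `e`. -/
theorem exists_covBy_of_mem_Γ {B : G.Flat} {e : E} (he : e ∈ B.Γ) :
    ∃ C : G.Flat, C ⋖ B ∧ C.rank = B.rank + 1 ∧ ∀ D : G.Flat, D ≤ B → e ∈ D.ξ → D ≤ C := by
  obtain ⟨Y, hY, rfl⟩ := exists_flatOf B
  obtain ⟨h1, h2⟩ := he
  have hr : (G.flatOf _ h2).rank = (G.flatOf Y hY).rank + 1 :=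
    Finset.card_insert_of_notMem h1
  have hlt : G.flatOf _ h2 < G.flatOf Y hY := by
    refine lt_of_le_of_ne
      ((le_iff_subset hY).2 ⟨_, h2, Finset.subset_insert _ _, rfl⟩) fun h => ?_
    rw [h] at hr
    omega
  refine ⟨G.flatOf _ h2, covBy_of_rank_eq hlt hr, hr, fun D hD heD => ?_⟩
  refine le_flatOf_of_subset h2 ?_
  rw [Finset.coe_insert]
  exact Set.insert_subset heD ((subset_ξ hY).trans (ξ_antitone hD))

theorem rank_eq_of_covBy {A B : G.Flat} (h : A ⋖ B) : A.rank = B.rank + 1 := by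
  obtain ⟨e, he, heA⟩ := exists_mem_Γ_of_lt h.lt
  obtain ⟨C, hC, hr, hmax⟩ := exists_covBy_of_mem_Γ he
  rwa [h.eq_left_of_le_of_lt (hmax A h.le heA) hC.lt] at hr

/-- In an interval of length two, every intermediate flat is a coatom. -/
theorem covBy_covBy_of_between {A B C D : G.Flat} (hAC : A ⋖ C) (hCB : C ⋖ B) (hAD : A < D)
    (hDB : D < B) : A ⋖ D ∧ D ⋖ B := by
  have h1 := rank_eq_of_covBy hAC
  have h2 := rank_eq_of_covBy hCB
  have h3 := rank_lt_of_lt hAD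
  have h4 := rank_lt_of_lt hDB
  exact ⟨covBy_of_rank_eq hAD (by omega), covBy_of_rank_eq hDB (by omega)⟩

/-- Two flats covered by `B` coincide as soon as they share a continuation of `B`. -/
theorem eq_of_covBy_of_mem_ξ {B C D : G.Flat} (hC : C ⋖ B) (hD : D ⋖ B) {e : E} (he : e ∈ B.Γ)
    (heC : e ∈ C.ξ) (heD : e ∈ D.ξ) : C = D := by
  obtain ⟨F, hF, -, hmax⟩ := exists_covBy_of_mem_Γ he
  rw [← hC.eq_left_of_le_of_lt (hmax C hC.le heC) hF.lt,
    ← hD.eq_left_of_le_of_lt (hmax D hD.le heD) hF.lt]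

/-- A continuation of the join `A ∨ B` is not absorbed by both `A` and `B`, since otherwise both
would lie below a flat covered by the join. -/
theorem notMem_ξ_inter_of_mem_Γ_sup {A B : G.Flat} {e : E} (he : e ∈ (A ⊔ B).Γ)
    (heA : e ∈ A.ξ) : e ∉ B.ξ := by
  intro heB
  obtain ⟨C, hC, -, hmax⟩ := exists_covBy_of_mem_Γ he
  exact hC.lt.not_ge (sup_le (hmax A le_sup_left heA) (hmax B le_sup_right heB))

namespace IsCovectorOver

variable {A : G.Flat} {α : E → CovSign}

/-- The product fills in `β` where `α` vanishes. -/
theorem comp_of_eq_zero {B : G.Flat} {β : E → CovSign} (hα : IsCovectorOver A α)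
    (hβ : IsCovectorOver B β) {e : E} (he : e ∈ (A ⊔ B).Γ ∪ (A ⊔ B).ξ)
    (h0 : α e = CovSign.zero) : G.comp α β e = β e := by
  rw [comp, hα.supp_eq, hβ.supp_eq, if_pos he, h0, CovSign.zero_lt_iff]
  split_ifs with h
  · rfl
  · exact (not_not.1 h).symm

/-- On continuations of the join the value `1` does not occur in either factor, so a sign of `α`
is never overwritten. -/
theorem comp_of_ne_zero {B : G.Flat} {β : E → CovSign} (hα : IsCovectorOver A α)
    (hβ : IsCovectorOver B β) {e : E} (he : e ∈ (A ⊔ B).Γ)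
    (h0 : α e ≠ CovSign.zero) : G.comp α β e = α e := by
  have hα' : e ∈ A.Γ :=
    (Γ_subset_union le_sup_left he).resolve_right fun h => h0 (hα.eq_zero_iff.2 h)
  have hβ' : β e ≠ CovSign.one := by
    rcases Γ_subset_union (le_sup_right : B ≤ A ⊔ B) he with h | h
    · exact CovSign.sign_ne_one (hβ.1 e h)
    · rw [hβ.2.1 e h]; simp
  rw [comp, hα.supp_eq, hβ.supp_eq, if_pos (Set.mem_union_left _ he),
    if_neg (CovSign.not_lt_of_sign (hα.1 e hα') hβ')]

theorem comp {B : G.Flat} {β : E → CovSign} (hα : IsCovectorOver A α)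
    (hβ : IsCovectorOver B β) : IsCovectorOver (A ⊔ B) (G.comp α β) := by
  refine ⟨fun e he => ?_, fun e he => ?_, fun e h1 h2 => ?_⟩
  · by_cases h0 : α e = CovSign.zero
    · rw [hα.comp_of_eq_zero hβ (Or.inl he) h0, hβ.sign_iff]
      exact (Γ_subset_union le_sup_right he).resolve_right
        (notMem_ξ_inter_of_mem_Γ_sup he (hα.eq_zero_iff.1 h0))
    · rw [hα.comp_of_ne_zero hβ he h0, hα.sign_iff]
      exact (Γ_subset_union le_sup_left he).resolve_right fun h => h0 (hα.eq_zero_iff.2 h)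
  · rw [hα.comp_of_eq_zero hβ (Or.inr he) (hα.2.1 e (ξ_antitone le_sup_left he)),
      hβ.2.1 e (ξ_antitone le_sup_right he)]
  · rw [IntervalGreedoid.comp, hα.supp_eq, hβ.supp_eq, if_neg (fun h => h.elim h1 h2)]

end IsCovectorOver

end Flats

end IntervalGreedoid

/-! ### Products and negatives of covectors -/

namespace OrientedIntervalGreedoid

open IntervalGreedoid

variable {E : Type*} [Fintype E] [DecidableEq E] {O : OrientedIntervalGreedoid E}

namespace Covector

theorem overFlat (α : O.Covector) : IsCovectorOver α.flat α.1 := (O.isCovector α.1 α.2).over_supp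

/-- The negative of a covector, with `+` and `-` exchanged. -/
instance : Neg O.Covector := ⟨fun α => ⟨-α.1, O.neg_mem _ α.2⟩⟩

/-- The product of two covectors of an oriented interval greedoid. -/
noncomputable def comp (α β : O.Covector) : O.Covector :=
  ⟨O.toIntervalGreedoid.comp α.1 β.1, O.comp_mem _ α.2 _ β.2⟩

theorem flat_neg (α : O.Covector) : (-α).flat = α.flat := α.overFlat.neg.supp_eq

theorem flat_comp (α β : O.Covector) : (α.comp β).flat = α.flat ⊔ β.flat :=
  (α.overFlat.comp β.overFlat).supp_eq

theorem le_iff {α β : O.Covector} :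
    α ≤ β ↔ α.flat ≤ β.flat ∧ ∀ e ∈ α.flat.Γ ∩ β.flat.Γ, α.1 e = β.1 e := Iff.rfl

theorem le_comp (α β : O.Covector) : α ≤ α.comp β := by
  refine le_iff.2 ⟨by rw [flat_comp]; exact le_sup_left, fun e he => ?_⟩
  rw [flat_comp] at he
  exact (α.overFlat.comp_of_ne_zero β.overFlat he.2 (CovSign.sign_ne_zero (α.overFlat.1 e he.1))).symm

theorem eq_of_le_of_flat_eq {α β : O.Covector} (h : α ≤ β) (hf : α.flat = β.flat) : α = β :=
  le_antisymm h (le_iff.2 ⟨hf.ge, fun e he => (h.2 e ⟨he.2, he.1⟩).symm⟩)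

theorem flat_lt_of_lt {α β : O.Covector} (h : α < β) : α.flat < β.flat :=
  lt_of_le_of_ne h.le.1 fun hf => h.ne (eq_of_le_of_flat_eq h.le hf)

theorem lt_of_le_of_flat_lt {α β : O.Covector} (h : α ≤ β) (hf : α.flat < β.flat) : α < β :=
  lt_of_le_of_ne h fun he => hf.ne (he ▸ rfl)

/-- Covectors above `α` with the same flat coincide if they agree on `ξ(α)`. -/
theorem eq_of_ge_of_eqOn {α γ δ : O.Covector} (hγ : α ≤ γ) (hδ : α ≤ δ) (hf : δ.flat = γ.flat)
    (h : ∀ e ∈ γ.flat.Γ, e ∈ α.flat.ξ → δ.1 e = γ.1 e) : δ = γ := by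
  refine eq_of_le_of_flat_eq (le_iff.2 ⟨hf.le, fun e he => ?_⟩) hf
  rcases Γ_subset_union hγ.1 he.2 with h1 | h1
  · rw [← hγ.2 e ⟨h1, he.2⟩, ← hδ.2 e ⟨h1, he.1⟩]
  · exact h e he.2 h1

theorem comp_neg_flat {α γ : O.Covector} (h : α ≤ γ) : (α.comp (-γ)).flat = γ.flat := by
  rw [flat_comp, flat_neg, sup_eq_right.2 h.1]

/-- The covector `α ∘ (-γ)` is the reflection of `γ` in `α`: it has the opposite signs
on `ξ(α)`. -/
theorem comp_neg_apply {α γ : O.Covector} (h : α ≤ γ) {e : E} (he : e ∈ γ.flat.Γ)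
    (heα : e ∈ α.flat.ξ) : (α.comp (-γ)).1 e = -γ.1 e :=
  α.overFlat.comp_of_eq_zero (-γ).overFlat (Or.inl (by rwa [flat_neg, sup_eq_right.2 h.1]))
    (α.overFlat.2.1 e heα)

/-! ### Elimination above a covector -/

/-- If `δ` and `ε` lie above `α`, then the covector obtained from them by elimination can be
multiplied by `α` from the left to lie above `α` as well. Its flat is strictly below the join of
the flats of `δ` and `ε`, since it absorbs the eliminated continuation `x` of that join. -/
theorem exists_elimination {α δ ε : O.Covector} (hδ : α ≤ δ) (hε : α ≤ ε) {x : E}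
    (hx : x ∈ (δ.flat ⊔ ε.flat).Γ) (hxS : x ∈ separationSet δ.1 ε.1) :
    ∃ η : O.Covector, α ≤ η ∧ η.flat < δ.flat ⊔ ε.flat ∧ x ∈ η.flat.ξ ∧
      ∀ y ∈ (δ.flat ⊔ ε.flat).Γ, y ∉ separationSet δ.1 ε.1 → η.1 y = (δ.comp ε).1 y := by
  set B := δ.flat ⊔ ε.flat with hB
  have hAB : α.flat ≤ B := hδ.1.trans le_sup_left
  have hcomp := δ.overFlat.comp ε.overFlat
  rw [← hB] at hcomp
  obtain ⟨κ, hκ, hκx, hκy⟩ := O.elimination _ δ.2 _ ε.2 x hxS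
    (CovSign.sign_ne_one (hcomp.1 x hx))
  obtain ⟨κ, rfl⟩ : ∃ κ' : O.Covector, κ'.1 = κ := ⟨⟨κ, hκ⟩, rfl⟩
  have hxδ : x ∈ δ.flat.Γ := δ.overFlat.sign_iff.1 hxS.2
  have hxε : x ∈ ε.flat.Γ := by
    refine ε.overFlat.sign_iff.1 ?_
    have := CovSign.neg_sign hxS.2
    rwa [hxS.1, CovSign.neg_neg'] at this
  have hxα : x ∈ α.flat.ξ := by
    refine (Γ_subset_union hAB hx).resolve_left fun h => CovSign.sign_ne_neg hxS.2 ?_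
    rw [← hδ.2 x ⟨h, hxδ⟩, hε.2 x ⟨h, hxε⟩, ← hxS.1, ← hδ.2 x ⟨h, hxδ⟩, hε.2 x ⟨h, hxε⟩]
  -- Outside `Γ(B) ∪ ξ(B)` nothing is known about `κ`, but it vanishes on `ξ(B)`.
  have hκB : κ.flat ≤ B := by
    obtain ⟨Y, hY, hYB⟩ := exists_flatOf B
    rw [← hYB]
    refine le_flatOf_of_subset hY fun y hy => κ.overFlat.eq_zero_iff.1 ?_
    have h0 : y ∈ B.ξ := hYB ▸ subset_ξ hY hy
    have hyS : y ∉ separationSet δ.1 ε.1 := fun h =>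
      CovSign.sign_ne_zero h.2 (δ.overFlat.2.1 y (ξ_antitone le_sup_left h0))
    have hy0 := hcomp.2.1 y h0
    rw [(hκy y hyS (by rw [hy0]; simp)).1, hy0]
  obtain ⟨C, hC, -, hmax⟩ := exists_covBy_of_mem_Γ hx
  have hlt : (α.comp κ).flat < B := by
    rw [flat_comp]
    exact (sup_le (hmax _ hAB hxα) (hmax _ hκB (κ.overFlat.eq_zero_iff.1 hκx))).trans_lt hC.lt
  have hmem : ∀ y ∈ B.Γ, y ∈ (α.flat ⊔ κ.flat).Γ ∪ (α.flat ⊔ κ.flat).ξ := fun y hy =>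
    Γ_subset_union (sup_le hAB hκB) hy
  refine ⟨α.comp κ, le_comp _ _, hlt, ?_, fun y hy hyS => ?_⟩
  · refine (α.comp κ).overFlat.eq_zero_iff.1 ?_
    rw [← hκx]
    exact α.overFlat.comp_of_eq_zero κ.overFlat (hmem x hx) (α.overFlat.2.1 x hxα)
  · have hκ' : κ.1 y = (δ.comp ε).1 y := (hκy y hyS (CovSign.sign_ne_one (hcomp.1 y hy))).1
    rcases Γ_subset_union hAB hy with h | h
    · have hne := CovSign.sign_ne_zero (α.overFlat.1 y h)
      have hκα : κ.1 y = α.1 y := by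
        rw [hκ']
        refine (?_ : α.1 y = (δ.comp ε).1 y).symm
        exact (hδ.trans (le_comp δ ε)).2 y ⟨h, by rwa [flat_comp]⟩
      have hyΓ : y ∈ (α.flat ⊔ κ.flat).Γ := by
        refine Γ_inter_subset le_sup_left (sup_le hAB hκB) ⟨h, hy⟩
      rw [← hκ', hκα]
      exact α.overFlat.comp_of_ne_zero κ.overFlat hyΓ hne
    · rw [← hκ']
      exact α.overFlat.comp_of_eq_zero κ.overFlat (hmem y hy) (α.overFlat.2.1 y h)

/-- Over a covering pair of flats, a covector has exactly two extensions, which are reflections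
of each other: eliminating between a third one and `γ` would give an intermediate flat. -/
theorem eq_or_eq_comp_neg {α γ δ : O.Covector} (hγ : α ≤ γ) (hδ : α ≤ δ)
    (hcov : α.flat ⋖ γ.flat) (hf : δ.flat = γ.flat) : δ = γ ∨ δ = α.comp (-γ) := by
  by_contra! hne
  obtain ⟨x, hx, hxα, hxne⟩ : ∃ x ∈ γ.flat.Γ, x ∈ α.flat.ξ ∧ δ.1 x ≠ γ.1 x := by
    by_contra! h
    exact hne.1 (eq_of_ge_of_eqOn hγ hδ hf h)
  obtain ⟨y, hy, hyα, hyne⟩ : ∃ y ∈ γ.flat.Γ, y ∈ α.flat.ξ ∧ δ.1 y ≠ -γ.1 y := by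
    by_contra! h
    refine hne.2 (eq_of_ge_of_eqOn (le_comp _ _) hδ (by rw [comp_neg_flat hγ, hf]) ?_)
    intro e he heα
    rw [comp_neg_flat hγ] at he
    rw [comp_neg_apply hγ he heα, h e he heα]
  have hsup : δ.flat ⊔ γ.flat = γ.flat := by rw [hf, sup_idem]
  have hs : ∀ e ∈ γ.flat.Γ, δ.1 e = γ.1 e ∨ δ.1 e = -γ.1 e := fun e he =>
    CovSign.sign_eq_or_eq_neg (δ.overFlat.1 e (hf ▸ he)) (γ.overFlat.1 e he)
  obtain ⟨η, h1, h2, -, h4⟩ := exists_elimination hδ hγ (x := x) (by rwa [hsup])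
    ⟨(hs x hx).resolve_left hxne, δ.overFlat.1 x (hf ▸ hx)⟩
  rw [hsup] at h2 h4
  have hA : η.flat = α.flat := hcov.eq_left_of_le_of_lt h1.1 h2
  have hy0 := h4 y hy (fun h => hyne h.1)
  rw [η.overFlat.2.1 y (hA ▸ hyα)] at hy0
  have hyc : y ∈ (δ.comp γ).flat.Γ := by rwa [flat_comp, hsup]
  exact CovSign.sign_ne_zero ((δ.comp γ).overFlat.1 y hyc) hy0.symm

theorem le_of_separationSet_eq_empty {δ β : O.Covector} (hf : δ.flat ≤ β.flat)
    (h : separationSet δ.1 β.1 = ∅) : δ ≤ β := by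
  refine le_iff.2 ⟨hf, fun e he => ?_⟩
  refine (CovSign.sign_eq_or_eq_neg (δ.overFlat.1 e he.1) (β.overFlat.1 e he.2)).resolve_right
    fun h' => ?_
  have : e ∈ separationSet δ.1 β.1 := ⟨h', δ.overFlat.1 e he.1⟩
  simp [h] at this

/-- Repeated elimination between `δ` and `β` turns a covector `δ` above `α` into one that lies
strictly between `α` and `β`: each step shrinks the separation set, and leaves the result equal
to `β` outside it. -/
theorem exists_between {α β δ : O.Covector} (hβ : α ≤ β) (hδ : α ≤ δ) (hlt : δ.flat < β.flat)
    (hS : (separationSet δ.1 β.1).Nonempty) :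
    ∃ η : O.Covector, α < η ∧ η < β ∧
      ∀ y ∈ β.flat.Γ, y ∉ separationSet δ.1 β.1 → η.1 y = β.1 y := by
  induction hn : (separationSet δ.1 β.1).ncard using Nat.strong_induction_on generalizing δ with
  | _ n ih =>
    obtain ⟨x, hxS⟩ := hS
    have hsup : δ.flat ⊔ β.flat = β.flat := sup_eq_right.2 hlt.le
    have hSΓ : ∀ {κ : O.Covector} {e : E}, e ∈ separationSet κ.1 β.1 → e ∈ β.flat.Γ := by
      intro κ e he
      refine β.overFlat.sign_iff.1 ?_
      have := CovSign.neg_sign he.2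
      rwa [he.1, CovSign.neg_neg'] at this
    obtain ⟨η, h1, h2, h3, h4⟩ := exists_elimination hδ hβ (by rw [hsup]; exact hSΓ hxS) hxS
    rw [hsup] at h2 h4
    have h5 : ∀ y ∈ β.flat.Γ, y ∉ separationSet δ.1 β.1 → η.1 y = β.1 y := by
      intro y hy hyS
      rw [h4 y hy hyS]
      by_cases h0 : δ.1 y = CovSign.zero
      · exact δ.overFlat.comp_of_eq_zero β.overFlat (Or.inl (by rwa [hsup])) h0
      · have hyδ : y ∈ δ.flat.Γ := (Γ_subset_union hlt.le hy).resolve_right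
          fun h => h0 (δ.overFlat.2.1 y h)
        refine (δ.overFlat.comp_of_ne_zero β.overFlat (by rwa [hsup]) h0).trans ?_
        exact (CovSign.sign_eq_or_eq_neg (δ.overFlat.1 y hyδ) (β.overFlat.1 y hy)).resolve_right
          fun h => hyS ⟨h, δ.overFlat.1 y hyδ⟩
    -- An element of `Γ(β) ∩ ξ(δ)` is not separated, so `η` is nonzero there while `α` vanishes.
    have hαη : α < η := by
      refine lt_of_le_of_ne h1 ?_
      rintro rfl
      obtain ⟨e, he, heδ⟩ := exists_mem_Γ_of_lt hlt
      have := h5 e he fun h => CovSign.sign_ne_zero h.2 (δ.overFlat.2.1 e heδ)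
      rw [α.overFlat.2.1 e (ξ_antitone hδ.1 heδ)] at this
      exact CovSign.sign_ne_zero (β.overFlat.1 e he) this.symm
    have hsub : separationSet η.1 β.1 ⊆ separationSet δ.1 β.1 := by
      intro y hy
      by_contra hyS
      have := h5 y (hSΓ hy) hyS
      exact CovSign.sign_ne_neg hy.2 (hy.1.trans (congrArg Neg.neg this.symm))
    rcases (separationSet η.1 β.1).eq_empty_or_nonempty with hE | hE
    · exact ⟨η, hαη, lt_of_le_of_flat_lt (le_of_separationSet_eq_empty h2.le hE) h2, h5⟩
    · have hcard : (separationSet η.1 β.1).ncard < n := by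
        rw [← hn]
        refine Set.ncard_lt_ncard (Set.ssubset_iff_subset_ne.2 ⟨hsub, fun h => ?_⟩)
          (Set.toFinite _)
        rw [← h] at hxS
        exact CovSign.sign_ne_zero hxS.2 (η.overFlat.2.1 x h3)
      obtain ⟨ζ, k1, k2, k3⟩ := ih _ hcard h1 h2 hE rfl
      exact ⟨ζ, k1, k2, fun y hy hyS => k3 y hy fun h => hyS (hsub h)⟩

/-- Passing to flats preserves covering pairs. -/
theorem flat_covBy {α β : O.Covector} (h : α ⋖ β) : α.flat ⋖ β.flat := by
  refine ⟨flat_lt_of_lt h.lt, fun C hAC hCB => ?_⟩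
  obtain ⟨κ, hκ, hκC⟩ := O.supp_surjective C
  obtain ⟨κ, rfl⟩ : ∃ κ' : O.Covector, κ'.1 = κ := ⟨⟨κ, hκ⟩, rfl⟩
  have hf : (α.comp κ).flat = C := by
    rw [flat_comp]
    change α.flat ⊔ O.supp κ.1 = C
    rw [hκC, sup_eq_right.2 hAC.le]
  rcases (separationSet (α.comp κ).1 β.1).eq_empty_or_nonempty with hE | hE
  · exact h.2 (lt_of_le_of_flat_lt (le_comp _ _) (by rwa [hf]))
      (lt_of_le_of_flat_lt (le_of_separationSet_eq_empty (by rw [hf]; exact hCB.le) hE)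
        (by rwa [hf]))
  · obtain ⟨η, h1, h2, -⟩ := exists_between h.le (le_comp α κ) (by rwa [hf]) hE
    exact h.2 h1 h2

/-- Multiplying `γ` by a covector over the greatest flat `[∅]` gives a covector above `γ` over
that flat. -/
theorem flat_eq_of_isMax {γ : O.Covector} (h : IsMax γ) :
    γ.flat = O.toIntervalGreedoid.flatOf ∅ empty_mem := by
  obtain ⟨κ, hκ, hκC⟩ := O.supp_surjective (O.toIntervalGreedoid.flatOf ∅ empty_mem)
  obtain ⟨κ, rfl⟩ : ∃ κ' : O.Covector, κ'.1 = κ := ⟨⟨κ, hκ⟩, rfl⟩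
  have h1 : (γ.comp κ).flat = O.toIntervalGreedoid.flatOf ∅ empty_mem := by
    rw [flat_comp]
    change γ.flat ⊔ O.supp κ.1 = _
    rw [hκC, sup_eq_right.2 (flatOf_empty_le _ _)]
  rw [← h1]
  exact le_antisymm (le_comp γ κ).1 (h (le_comp γ κ)).1

theorem comp_neg_ne {α γ : O.Covector} (h : α < γ) : α.comp (-γ) ≠ γ := by
  intro heq
  obtain ⟨e, he, heα⟩ := exists_mem_Γ_of_lt (flat_lt_of_lt h)
  have := comp_neg_apply h.le he heα
  rw [heq] at this
  exact CovSign.sign_ne_neg (γ.overFlat.1 e he) this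

theorem lt_comp_neg {α γ : O.Covector} (h : α < γ) : α < α.comp (-γ) :=
  lt_of_le_of_flat_lt (le_comp _ _) (by rw [comp_neg_flat h.le]; exact flat_lt_of_lt h)

/-! ### Intervals of length two -/

/-- Between `α` and `β` there is a second covector besides `γ`: the reflection of `γ` in `α`, or
what elimination between this reflection and `β` leads to. -/
theorem exists_ne_between {α β γ : O.Covector} (h1 : α < γ) (h2 : γ < β) :
    ∃ δ : O.Covector, δ ≠ γ ∧ α < δ ∧ δ < β := by
  have hf := comp_neg_flat h1.le
  have hlt : (α.comp (-γ)).flat < β.flat := by rw [hf]; exact flat_lt_of_lt h2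
  rcases (separationSet (α.comp (-γ)).1 β.1).eq_empty_or_nonempty with hE | hE
  · exact ⟨_, comp_neg_ne h1, lt_comp_neg h1,
      lt_of_le_of_flat_lt (le_of_separationSet_eq_empty hlt.le hE) hlt⟩
  · obtain ⟨η, k1, k2, k3⟩ := exists_between (h1.trans h2).le (le_comp α (-γ)) hlt hE
    refine ⟨η, ?_, k1, k2⟩
    rintro rfl
    obtain ⟨e, he, heη⟩ := exists_mem_Γ_of_lt (flat_lt_of_lt h2)
    -- A continuation of `β` absorbed by `γ` is absorbed by its reflection, so it is not separated.
    have h0 := k3 e he fun h => CovSign.sign_ne_zero h.2 ((α.comp (-η)).overFlat.2.1 e (hf ▸ heη))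
    rw [η.overFlat.2.1 e heη] at h0
    exact CovSign.sign_ne_zero (β.overFlat.1 e he) h0.symm

/-- If both extensions of `α` over the same flat lie below `β`, this flat absorbs all of
`Γ(β) ∩ ξ(α)`, so that no other flat is possible between `α` and `β`. -/
theorem flat_eq_of_between {α β γ γ' δ : O.Covector} (hcov : α.flat ⋖ γ.flat)
    (hcovB : γ.flat ⋖ β.flat) (h1 : α < γ) (h2 : γ < β) (h1' : α < γ') (h2' : γ' < β)
    (hne : γ' ≠ γ) (hf : γ'.flat = γ.flat) (k1 : α < δ) (k2 : δ < β) : δ.flat = γ.flat := by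
  have hcovD := (covBy_covBy_of_between hcov hcovB (flat_lt_of_lt k1) (flat_lt_of_lt k2)).2
  obtain ⟨e, he, heδ⟩ := exists_mem_Γ_of_lt hcovD.lt
  have heα : e ∈ α.flat.ξ := ξ_antitone k1.le.1 heδ
  refine eq_of_covBy_of_mem_ξ hcovD hcovB he heδ ?_
  refine (Γ_subset_union h2.le.1 he).resolve_left fun heγ => ?_
  have hγ' := (eq_or_eq_comp_neg h1.le h1'.le hcov hf).resolve_left hne
  have hneg := comp_neg_apply h1.le heγ heα
  rw [← hγ', h2'.le.2 e ⟨hf ▸ heγ, he⟩, ← h2.le.2 e ⟨heγ, he⟩] at hneg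
  exact CovSign.sign_ne_neg (γ.overFlat.1 e heγ) hneg

/-- Three covectors between `α` and `β` cannot have three different flats. With `β` positive, on
continuations of `β` absorbed by the respective flats they have the signs `(0,+,+)`, `(+,0,+)`,
`(+,+,0)`. Elimination of the second element between the first covector and the reflection
`(-,-,0)` of the third leads to `(-,0,+)`, a third extension of `α` over the second flat. -/
theorem false_of_three_flats {α β γ₁ γ₂ γ₃ : O.Covector}
    (hcov : α.flat ⋖ γ₂.flat) (hcovB : γ₂.flat ⋖ β.flat)
    (h1 : α < γ₁) (k1 : γ₁ < β) (h2 : α < γ₂) (k2 : γ₂ < β) (h3 : α < γ₃) (k3 : γ₃ < β)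
    (h12 : γ₁.flat ≠ γ₂.flat) (h13 : γ₁.flat ≠ γ₃.flat) (h23 : γ₂.flat ≠ γ₃.flat) : False := by
  have c1 := (covBy_covBy_of_between hcov hcovB (flat_lt_of_lt h1) (flat_lt_of_lt k1)).2
  have c3 := (covBy_covBy_of_between hcov hcovB (flat_lt_of_lt h3) (flat_lt_of_lt k3)).2
  have hsign : ∀ {γ δ : O.Covector}, γ.flat ⋖ β.flat → δ < β → δ.flat ⋖ β.flat →
      γ.flat ≠ δ.flat → ∀ {e : E}, e ∈ β.flat.Γ → e ∈ γ.flat.ξ → e ∈ δ.flat.Γ ∧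
        δ.1 e = β.1 e := by
    intro γ δ hγ hδ hδ' hne e he heγ
    have heδ := (Γ_subset_union hδ.le.1 he).resolve_right
      fun h => hne (eq_of_covBy_of_mem_ξ hγ hδ' he heγ h)
    exact ⟨heδ, hδ.le.2 e ⟨heδ, he⟩⟩
  obtain ⟨y₁, hy₁, hyC₁⟩ := exists_mem_Γ_of_lt c1.lt
  obtain ⟨y₂, hy₂, hyC₂⟩ := exists_mem_Γ_of_lt hcovB.lt
  obtain ⟨y₃, hy₃, hyC₃⟩ := exists_mem_Γ_of_lt c3.lt
  have hyα₁ : y₁ ∈ α.flat.ξ := ξ_antitone h1.le.1 hyC₁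
  have hyα₂ : y₂ ∈ α.flat.ξ := ξ_antitone h2.le.1 hyC₂
  obtain ⟨-, s12⟩ := hsign hcovB k1 c1 h12.symm hy₂ hyC₂
  obtain ⟨g13, s13⟩ := hsign c3 k1 c1 h13.symm hy₃ hyC₃
  obtain ⟨g21, s21⟩ := hsign c1 k2 hcovB h12 hy₁ hyC₁
  obtain ⟨g23, s23⟩ := hsign c3 k2 hcovB h23.symm hy₃ hyC₃
  obtain ⟨g31, s31⟩ := hsign c1 k3 c3 h13 hy₁ hyC₁
  obtain ⟨g32, s32⟩ := hsign hcovB k3 c3 h23 hy₂ hyC₂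
  set ρ := α.comp (-γ₃) with hρ
  have hρf : ρ.flat = γ₃.flat := comp_neg_flat h3.le
  have hρ1 : ρ.1 y₁ = -β.1 y₁ := by rw [hρ, comp_neg_apply h3.le g31 hyα₁, s31]
  have hρ2 : ρ.1 y₂ = -β.1 y₂ := by rw [hρ, comp_neg_apply h3.le g32 hyα₂, s32]
  have hρ3 : ρ.1 y₃ = CovSign.zero := ρ.overFlat.2.1 y₃ (hρf ▸ hyC₃)
  have hsup : γ₁.flat ⊔ ρ.flat = β.flat := by
    refine c1.eq_right_of_lt_of_le (lt_of_le_of_ne le_sup_left fun h => ?_)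
      (sup_le c1.le (hρf ▸ c3.le))
    have hle : γ₃.flat ≤ γ₁.flat := by rw [← hρf, h]; exact le_sup_right
    exact h13 (c3.eq_left_of_le_of_lt hle c1.lt)
  have hz1 : γ₁.1 y₁ = CovSign.zero := γ₁.overFlat.2.1 y₁ hyC₁
  obtain ⟨η, e1, e2, e3, e4⟩ := exists_elimination h1.le (le_comp α (-γ₃)) (x := y₂)
    (by rw [← hρ, hsup]; exact hy₂)
    ⟨by rw [← hρ, hρ2, s12, CovSign.neg_neg'], s12 ▸ β.overFlat.1 y₂ hy₂⟩
  rw [← hρ, hsup] at e2 e4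
  have v1 : η.1 y₁ = -β.1 y₁ := by
    rw [e4 y₁ hy₁ fun h => CovSign.sign_ne_zero h.2 hz1, ← hρ1]
    exact γ₁.overFlat.comp_of_eq_zero ρ.overFlat (Or.inl (by rwa [hsup])) hz1
  have v3 : η.1 y₃ = β.1 y₃ := by
    rw [e4 y₃ hy₃ fun h => CovSign.sign_ne_zero h.2 (by
      rw [h.1, hρ3, CovSign.neg_zero']), ← s13]
    exact γ₁.overFlat.comp_of_ne_zero ρ.overFlat (by rwa [hsup])
      (CovSign.sign_ne_zero (γ₁.overFlat.1 _ g13))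
  have hαη : α.flat < η.flat := by
    refine lt_of_le_of_ne e1.1 fun h => ?_
    rw [η.overFlat.2.1 y₁ (h ▸ hyα₁)] at v1
    exact CovSign.sign_ne_zero (CovSign.neg_sign (β.overFlat.1 y₁ hy₁)) v1.symm
  have hηf : η.flat = γ₂.flat := eq_of_covBy_of_mem_ξ
    (covBy_covBy_of_between hcov hcovB hαη e2).2 hcovB hy₂ e3 hyC₂
  rcases eq_or_eq_comp_neg h2.le e1 hcov hηf with h | h
  · rw [h, s21] at v1
    exact CovSign.sign_ne_neg (β.overFlat.1 y₁ hy₁) v1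
  · rw [h, comp_neg_apply h2.le g23 (ξ_antitone h3.le.1 hyC₃), s23] at v3
    exact CovSign.sign_ne_neg (β.overFlat.1 y₃ hy₃) v3.symm

/-- Among three covectors in an interval of length two, two have the same flat; then all three are
extensions of `α` over this flat, so that two of them are equal. -/
theorem eq_or_eq_of_between {α β γ δ κ : O.Covector} (hαγ : α ⋖ γ) (hγβ : γ ⋖ β)
    (hδ : δ ≠ γ) (h1 : α < δ) (h2 : δ < β) (k1 : α < κ) (k2 : κ < β) : κ = γ ∨ κ = δ := by
  have c1 := flat_covBy hαγ
  have c2 := flat_covBy hγβ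
  by_contra! hne
  -- Three distinct covectors in the interval have pairwise different flats.
  have key : ∀ {γ δ κ : O.Covector}, α.flat ⋖ γ.flat → γ.flat ⋖ β.flat → α < γ → γ < β →
      α < δ → δ < β → α < κ → κ < β → δ ≠ γ → κ ≠ γ → κ ≠ δ → δ.flat ≠ γ.flat := by
    intro γ δ κ c1 c2 a1 a2 b1 b2 d1 d2 n1 n2 n3 hf
    have hf' := flat_eq_of_between c1 c2 a1 a2 b1 b2 n1 hf d1 d2
    exact n3 (((eq_or_eq_comp_neg a1.le d1.le c1 hf').resolve_left n2).trans
      ((eq_or_eq_comp_neg a1.le b1.le c1 hf).resolve_left n1).symm)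
  obtain ⟨d1, d2⟩ := covBy_covBy_of_between c1 c2 (flat_lt_of_lt h1) (flat_lt_of_lt h2)
  exact false_of_three_flats c1 c2 h1 h2 hαγ.lt hγβ.lt k1 k2
    (key c1 c2 hαγ.lt hγβ.lt h1 h2 k1 k2 hδ hne.1 hne.2)
    (key d1 d2 h1 h2 k1 k2 hαγ.lt hγβ.lt hne.2 hδ.symm hne.1.symm).symm
    (key c1 c2 hαγ.lt hγβ.lt k1 k2 h1 h2 hne.1 hδ hne.2.symm).symm

end Covector

end OrientedIntervalGreedoid

/-! ### Thinness -/

theorem ncard_Icc_eq_four {P : Type*} [PartialOrder P] {a b c d : P} (hac : a < c) (hcb : c < b)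
    (had : a < d) (hdb : d < b) (hdc : d ≠ c) (h : ∀ x, a < x → x < b → x = c ∨ x = d) :
    (Set.Icc a b).ncard = 4 := by
  classical
  have hset : Set.Icc a b = (({a, c, d, b} : Finset P) : Set P) := by
    ext x
    simp only [Set.mem_Icc, Finset.coe_insert, Finset.coe_singleton, Set.mem_insert_iff,
      Set.mem_singleton_iff]
    constructor
    · rintro ⟨h1, h2⟩
      rcases h1.eq_or_lt with h1 | h1
      · exact Or.inl h1.symm
      rcases h2.eq_or_lt with h2 | h2
      · exact Or.inr (Or.inr (Or.inr h2))
      rcases h x h1 h2 with h | h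
      exacts [Or.inr (Or.inl h), Or.inr (Or.inr (Or.inl h))]
    · rintro (rfl | rfl | rfl | rfl)
      exacts [⟨le_rfl, (hac.trans hcb).le⟩, ⟨hac.le, hcb.le⟩, ⟨had.le, hdb.le⟩,
        ⟨(hac.trans hcb).le, le_rfl⟩]
  rw [hset, Set.ncard_coe_finset, Finset.card_insert_of_notMem, Finset.card_insert_of_notMem,
    Finset.card_insert_of_notMem, Finset.card_singleton]
  · simpa using hdb.ne
  · simpa using ⟨hdc.symm, hcb.ne⟩
  · simpa using ⟨hac.ne, had.ne, (hac.trans hcb).ne⟩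

open OrientedIntervalGreedoid OrientedIntervalGreedoid.Covector in
theorem mainTheorem6 {E : Type*} [Fintype E] [DecidableEq E] (O : OrientedIntervalGreedoid E) :
    IsThin O.Hat := by
  rintro a b ⟨c, hac, hcb⟩
  lift c to O.Covector using hcb.lt.ne_top
  lift a to O.Covector using (hac.lt.trans hcb.lt).ne_top
  have hac := WithTop.coe_covBy_coe.1 hac
  induction b using WithTop.recTopCoe with
  | top =>
    have hmax : IsMax c := fun d hd => by
      by_contra hn
      exact hcb.2 (WithTop.coe_lt_coe.2 (lt_of_le_not_ge hd hn)) (WithTop.coe_lt_top d)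
    have hf := flat_eq_of_isMax hmax
    have hcov := flat_covBy hac
    refine ncard_Icc_eq_four (WithTop.coe_lt_coe.2 hac.lt) hcb.lt
      (WithTop.coe_lt_coe.2 (lt_comp_neg hac.lt)) (WithTop.coe_lt_top _)
      (fun h => comp_neg_ne hac.lt (WithTop.coe_injective h)) fun x hax hx => ?_
    lift x to O.Covector using hx.ne
    have hax := WithTop.coe_lt_coe.1 hax
    have hxf : x.flat = c.flat := hcov.eq_right_of_lt_of_le (flat_lt_of_lt hax)
      (hf ▸ IntervalGreedoid.flatOf_empty_le _ _)
    simpa only [WithTop.coe_inj] using eq_or_eq_comp_neg hac.le hax.le hcov hxf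
  | coe b =>
    have hcb := WithTop.coe_covBy_coe.1 hcb
    obtain ⟨d, hdc, had, hdb⟩ := exists_ne_between hac.lt hcb.lt
    refine ncard_Icc_eq_four (WithTop.coe_lt_coe.2 hac.lt) (WithTop.coe_lt_coe.2 hcb.lt)
      (WithTop.coe_lt_coe.2 had) (WithTop.coe_lt_coe.2 hdb)
      (fun h => hdc (WithTop.coe_injective h)) fun x hax hx => ?_
    lift x to O.Covector using hx.ne_top
    simpa only [WithTop.coe_inj] using eq_or_eq_of_between hac hcb hdc had hdb
      (WithTop.coe_lt_coe.1 hax) (WithTop.coe_lt_coe.1 hx)
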